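/- Let $N\ge 2$, $n\ge 1$, $\omega=e^{2\pi i/N}$, $\epsilon=(-1)^N$, and let $\varkappa_m\neq0$, $a_m,b_m,c_m,d_m$ ($1\le m\le n$) be complex parameters. Put $$\mathcal L_m(\Lambda)=\begin{pmatrix}1-\epsilon\varkappa_m^N\Lambda & -\epsilon\Lambda(a_m^N-b_m^N)\\ c_m^N-d_m^N & b_m^Nd_m^N/\varkappa_m^N-\epsilon\Lambda a_m^Nc_m^N\end{pmatrix},\qquad \mathcal T_m=\mathcal L_1\cdots\mathcal L_m=\begin{pmatrix}\mathcal A_m&\mathcal B_m\\ \mathcal C_m&\mathcal D_m\end{pmatrix}.$$ Fix numbers $r_m$ with $r_m^N=a_m^N-b_m^N$ and $r_{m,s}$ ($1\le m\le n$, $0\le s\le m-1$) with $$\mathcal B_m(\Lambda)=(-\epsilon)^m\Lambda\, r_{m,0}^N\prod_{s=1}^{m-1}(\Lambda-\epsilon r_{m,s}^N),$$ and assume that all $r_m$ and $r_{m,s}$ are nonzero, that $r_{m,1}^N,\dots,r_{m,m-1}^N$ are pairwise distinct for every $m$, and that $\det\mathcal T_n(\epsilon r_{n,s}^N)\ne0$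 for $1\le s\le n-1$. For $1\le m,m'\le n$, $1\le s\le m-1$, $1\le s'\le m'-1$ fix $y^{m,s}_{m',s'}$ with $(r_{m,s}/r_{m',s'})^N+(y^{m,s}_{m',s'})^N=1$. Let $\tilde r_m=r_{m,0}r_{m,1}\cdots r_{m,m-1}$ (so $\tilde r_0=1$) and, for $1\le k\le n-1$, $$\chi_k=\frac{r_{n,0}\,\tilde r_{n-1}}{r_n\,\tilde r_n}\prod_{1\le s\le n-1,\ s\ne k}\frac{y^{n,s}_{n,k}}{y^{n,k}_{n,s}}\;\prod_{s=1}^{n-2}y^{n,k}_{n-1,s}.$$ Let $F_m(\lambda)=(b_m+\omega a_m\varkappa_m\lambda)(\lambda c_m+d_m/\varkappa_m)$, $z(\lambda)=\prod_{m=1}^nF_m(\lambda/\omega)$ and, for $\rho\in\mathbb Z/N$, $$\Delta_+^{(k)}(\lambda)=\frac{\omega^\rho}{\chi_k}\Big(\frac{\lambda}{\omega}\Big)^{1-n}\prod_{m=1}^{n-1}F_m(\lambda/\omega),\qquad \Delta_-^{(k)}(\lambda)=\chi_k\Big(\frac{\lambda}{\omega}\Big)^{n-1}F_n(\lambda/\omega).$$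 Let $E_1,\dots,E_{n-1}\in\mathbb C$ be arbitrary and $t(\lambda)=E_0+E_1\lambda+\cdots+E_n\lambda^n$ with $$E_0=1+\omega^\rho\prod_{m=1}^n\frac{b_md_m}{\varkappa_m},\qquad E_n=\prod_{m=1}^na_mc_m+\omega^\rho\prod_{m=1}^n\varkappa_m .$$ Define $\tau^{(0)}=0$, $\tau^{(1)}=1$, $\tau^{(2)}=t$ and, for $j\ge2$, $$\tau^{(j+1)}(\lambda)=t(\omega^{j-1}\lambda)\,\tau^{(j)}(\lambda)-\omega^\rho z(\omega^{j-1}\lambda)\,\tau^{(j-1)}(\lambda).$$ Then the truncation identity $$\tau^{(N+1)}(\lambda)-\omega^\rho z(\lambda)\,\tau^{(N-1)}(\omega\lambda)=\mathcal A_n(\lambda^N)+\mathcal D_n(\lambda^N)\qquad(\lambda\in\mathbb C)$$ holds if and only if for every $k=1,\dots,n-1$ there is a function $q\colon\mathbb Z/N\to\mathbb C$, not identically zero, such that for all $\gamma\in\mathbb Z/N$, with $\lambda_{k}(\gamma)=-r_{n,k}\,\omega^{-\gamma}$, $$t(\lambda_k(\gamma))\,q(\gamma)=\Delta_+^{(k)}(\lambda_k(\gamma))\,q(\gamma+1)+\Delta_-^{(k)}(\omega\lambda_k(\gamma))\,q(\gamma-1).$$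 -/

import Mathlib

namespace BBS

open scoped BigOperators

/-- The primitive root of unity `ω = exp (2 π i / N)`. -/
noncomputable def omega (N : ℕ) : ℂ :=
  Complex.exp (2 * (Real.pi : ℂ) * Complex.I / (N : ℂ))

/-- The sign `ε = (-1) ^ N`. -/
def eps (N : ℕ) : ℂ := (-1) ^ N

/-- `ω ^ ρ` for a residue class `ρ` modulo `N`. -/
noncomputable def omegaPow (N : ℕ) (ρ : ZMod N) : ℂ := omega N ^ ρ.val

/-- The parameters `ϰ_k, a_k, b_k, c_k, d_k` of the inhomogeneous chain. For a chain with `n`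
sites only the values at `k = 1, …, n` are used. -/
structure Params where
  kap : ℕ → ℂ
  a : ℕ → ℂ
  b : ℕ → ℂ
  c : ℕ → ℂ
  d : ℕ → ℂ

/-- The classical `L`-operator of the `k`-th site, as a function of `Λ = λ ^ N`. -/
noncomputable def classicalL (N : ℕ) (P : Params) (k : ℕ) (Lam : ℂ) :
    Matrix (Fin 2) (Fin 2) ℂ :=
  !![1 - eps N * P.kap k ^ N * Lam, -eps N * Lam * (P.a k ^ N - P.b k ^ N);
     P.c k ^ N - P.d k ^ N,
       P.b k ^ N * P.d k ^ N / P.kap k ^ N - eps N * Lam * P.a k ^ N * P.c k ^ N]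

/-- The classical monodromy `𝓣_m = 𝓛_1 𝓛_2 ⋯ 𝓛_m`. -/
noncomputable def classicalT (N : ℕ) (P : Params) : ℕ → ℂ → Matrix (Fin 2) (Fin 2) ℂ
  | 0, _ => 1
  | m + 1, Lam => classicalT N P m Lam * classicalL N P (m + 1) Lam

/-- The entries of `𝓣_m` that are used: `𝓐_m`, `𝓑_m`, `𝓓_m`. -/
noncomputable def classicalA (N : ℕ) (P : Params) (m : ℕ) (Lam : ℂ) : ℂ :=
  classicalT N P m Lam 0 0

noncomputable def classicalB (N : ℕ) (P : Params) (m : ℕ) (Lam : ℂ) : ℂ :=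
  classicalT N P m Lam 0 1

noncomputable def classicalD (N : ℕ) (P : Params) (m : ℕ) (Lam : ℂ) : ℂ :=
  classicalT N P m Lam 1 1

/-- A choice of amplitudes for the chain with `n` sites: `site m` is `r_m`, `r m s` is `r_{m,s}`
(`1 ≤ m ≤ n`, `0 ≤ s ≤ m - 1`), and `y m s m' s'` is the second coordinate of the point of the
Fermat curve with first coordinate `r_{m,s} / r_{m',s'}` (`s, s' ≥ 1`). The `N`-th powers of all
these numbers are prescribed; the choice of the roots, and the numbering of the zeros of `𝓑_m`,
are arbitrary. -/
structure Amplitudes (N n : ℕ) (P : Params) where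
  site : ℕ → ℂ
  r : ℕ → ℕ → ℂ
  y : ℕ → ℕ → ℕ → ℕ → ℂ
  site_pow : ∀ m ∈ Finset.Icc 1 n, site m ^ N = P.a m ^ N - P.b m ^ N
  factor_B : ∀ m ∈ Finset.Icc 1 n, ∀ Lam : ℂ,
    classicalB N P m Lam =
      (-eps N) ^ m * Lam * r m 0 ^ N *
        ∏ s ∈ Finset.Icc 1 (m - 1), (Lam - eps N * r m s ^ N)
  fermat : ∀ m ∈ Finset.Icc 1 n, ∀ m' ∈ Finset.Icc 1 n,
    ∀ s ∈ Finset.Icc 1 (m - 1), ∀ s' ∈ Finset.Icc 1 (m' - 1),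
      (r m s / r m' s') ^ N + y m s m' s' ^ N = 1

/-- The nondegeneracy conditions: `ϰ_m ≠ 0` and `r_m ≠ 0`, the polynomials `𝓑_m(Λ) / Λ`
(`1 ≤ m ≤ n`) do not vanish identically and have nonzero simple zeros, and `det 𝓣_n` does not
vanish at the zeros of `𝓑_n(Λ) / Λ`. -/
structure Generic (N n : ℕ) (P : Params) (R : Amplitudes N n P) : Prop where
  kap_ne : ∀ m ∈ Finset.Icc 1 n, P.kap m ≠ 0
  site_ne : ∀ m ∈ Finset.Icc 1 n, R.site m ≠ 0
  r_ne : ∀ m ∈ Finset.Icc 1 n, ∀ s ∈ Finset.range m, R.r m s ≠ 0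
  simple : ∀ m ∈ Finset.Icc 1 n, ∀ s ∈ Finset.Icc 1 (m - 1), ∀ s' ∈ Finset.Icc 1 (m - 1),
    s ≠ s' → R.r m s ^ N ≠ R.r m s' ^ N
  det_ne : ∀ s ∈ Finset.Icc 1 (n - 1), (classicalT N P n (eps N * R.r n s ^ N)).det ≠ 0

/-- `F_m(λ) = (b_m + ω a_m ϰ_m λ) (λ c_m + d_m / ϰ_m)`. -/
noncomputable def F (N : ℕ) (P : Params) (m : ℕ) (lam : ℂ) : ℂ :=
  (P.b m + omega N * P.a m * P.kap m * lam) * (lam * P.c m + P.d m / P.kap m)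

/-- `z(λ) = ∏_{m=1}^n F_m(λ / ω)`. -/
noncomputable def z (N n : ℕ) (P : Params) (lam : ℂ) : ℂ :=
  ∏ m ∈ Finset.Icc 1 n, F N P m (lam / omega N)

/-- The polynomial `t(λ) = E_0 + E_1 λ + ⋯ + E_n λ ^ n` in the sector `ρ`, with the prescribed
values of `E_0` and `E_n`; only the values `E_1, …, E_{n-1}` of `E` are used. -/
noncomputable def t (N n : ℕ) (P : Params) (ρ : ZMod N) (E : ℕ → ℂ) (lam : ℂ) : ℂ :=
  (1 + omegaPow N ρ * ∏ m ∈ Finset.Icc 1 n, P.b m * P.d m / P.kap m)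
    + ∑ j ∈ Finset.Icc 1 (n - 1), E j * lam ^ j
    + (∏ m ∈ Finset.Icc 1 n, P.a m * P.c m
        + omegaPow N ρ * ∏ m ∈ Finset.Icc 1 n, P.kap m) * lam ^ n

/-- The fusion hierarchy `τ^{(j)}`. -/
noncomputable def tau (N n : ℕ) (P : Params) (ρ : ZMod N) (E : ℕ → ℂ) : ℕ → ℂ → ℂ
  | 0, _ => 0
  | 1, _ => 1
  | 2, lam => t N n P ρ E lam
  | j + 3, lam =>
      t N n P ρ E (omega N ^ (j + 1) * lam) * tau N n P ρ E (j + 2) lam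
        - omegaPow N ρ * z N n P (omega N ^ (j + 1) * lam) * tau N n P ρ E (j + 1) lam

variable {N n : ℕ} {P : Params}

/-- `r̃_m = r_{m,0} r_{m,1} ⋯ r_{m,m-1}`. -/
noncomputable def rTilde (R : Amplitudes N n P) (m : ℕ) : ℂ :=
  ∏ s ∈ Finset.range m, R.r m s

/-- The zeros `λ_{n,k} = - r_{n,k} ω ^ (-γ)`, `γ ∈ ℤ/N`. -/
noncomputable def root (R : Amplitudes N n P) (k : ℕ) (γ : ZMod N) : ℂ :=
  -(R.r n k) * (omegaPow N γ)⁻¹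

/-- The constant `χ_k`; `R.y n s n k` is `y^{n,s}_{n,k}`. -/
noncomputable def chi (R : Amplitudes N n P) (k : ℕ) : ℂ :=
  R.r n 0 * rTilde R (n - 1) / (R.site n * rTilde R n)
    * (∏ s ∈ (Finset.Icc 1 (n - 1)).erase k, R.y n s n k / R.y n k n s)
    * ∏ s ∈ Finset.Icc 1 (n - 2), R.y n k (n - 1) s

/-- `Δ_+(λ) = (ω ^ ρ / χ_k) (λ / ω) ^ (1 - n) ∏_{m=1}^{n-1} F_m(λ / ω)`. -/
noncomputable def DeltaPlus (R : Amplitudes N n P) (ρ : ZMod N) (k : ℕ) (lam : ℂ) : ℂ :=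
  omegaPow N ρ / chi R k * (lam / omega N) ^ (1 - (n : ℤ))
    * ∏ m ∈ Finset.Icc 1 (n - 1), F N P m (lam / omega N)

/-- `Δ_-(λ) = χ_k (λ / ω) ^ (n - 1) F_n(λ / ω)`. -/
noncomputable def DeltaMinus (R : Amplitudes N n P) (k : ℕ) (lam : ℂ) : ℂ :=
  chi R k * (lam / omega N) ^ ((n : ℤ) - 1) * F N P n (lam / omega N)

/-- The `k`-th Baxter system for a function `q` on `ℤ/N`. -/
def IsBaxterSolution (R : Amplitudes N n P) (ρ : ZMod N) (E : ℕ → ℂ) (k : ℕ)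
    (q : ZMod N → ℂ) : Prop :=
  ∀ γ : ZMod N,
    t N n P ρ E (root R k γ) * q γ =
      DeltaPlus R ρ k (root R k γ) * q (γ + 1)
        + DeltaMinus R k (omega N * root R k γ) * q (γ - 1)

end BBS

namespace BBS

open Polynomial

/-! The left side of the truncation identity is the trace of a product of N companion matrices
(`trace_orderedProd_companion`). Cyclicity of the trace makes it invariant under λ ↦ ωλ, so it is a
polynomial of degree at most n in Λ = λ^N (`exists_fusionTrace_poly`). The prescribed E_0 and E_n
make its coefficients of degree 0 and n agree with those of 𝓐_n + 𝓓_n. The identity therefore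
amounts to equality at n - 1 further distinct nonzero points, taken to be the zeros ε r_{n,k}^N of
𝓑_n(Λ)/Λ (`fusionTrace_eq_iff`).

The k-th Baxter system lives on the N-th roots of such a zero. It has a nonzero solution iff its
monodromy has eigenvalue 1, that is, iff the trace equals the sum of the products of Δ_+ and Δ_-
over the orbit (`exists_cyclic_solution_iff`); the trace is the fusion trace because Δ_+ Δ_- = ω^ρ
z. Where 𝓑_n vanishes, 𝓣_n is triangular and 𝓐_n 𝓓_n = det 𝓣_n; the constant χ_k is tuned so that
the two orbit products are exactly 𝓓_n and 𝓐_n (`prod_Delta_eq`). -/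

/-- Continuants of a three-term recursion `G (j + 2) = x j * G (j + 1) - w j * G j`. -/
def continuant {R : Type*} [CommRing R] (x w : ℕ → R) : ℕ → R
  | 0 => 0
  | 1 => 1
  | j + 2 => x j * continuant x w (j + 1) - w j * continuant x w j

/-- The trace of the monodromy of a three-term recursion over `M + 1` steps. -/
def cyclicTrace {R : Type*} [CommRing R] (x w : ℕ → R) (M : ℕ) : R :=
  continuant x w (M + 2) - w 0 * continuant (fun j => x (j + 1)) (fun j => w (j + 1)) M

/-- The ordered product `K (j - 1) * ⋯ * K 0`. -/
def orderedProd {R : Type*} [CommRing R] (K : ℕ → Matrix (Fin 2) (Fin 2) R) :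
    ℕ → Matrix (Fin 2) (Fin 2) R
  | 0 => 1
  | j + 1 => K j * orderedProd K j

/-! ### Continuants, traces of periodic recursions, and their top coefficients -/

section General

variable {R S : Type*} [CommRing R] [CommRing S]

theorem continuant_map (f : R →+* S) (x w : ℕ → R) :
    ∀ j, f (continuant x w j) = continuant (fun i => f (x i)) (fun i => f (w i)) j
  | 0 => by simp [continuant]
  | 1 => by simp [continuant]
  | j + 2 => by
      simp [continuant, continuant_map f x w (j + 1), continuant_map f x w j]

theorem cyclicTrace_map (f : R →+* S) (x w : ℕ → R) (M : ℕ) :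
    f (cyclicTrace x w M) = cyclicTrace (fun i => f (x i)) (fun i => f (w i)) M := by
  simp [cyclicTrace, continuant_map]

theorem orderedProd_succ' (K : ℕ → Matrix (Fin 2) (Fin 2) R) (j : ℕ) :
    orderedProd K (j + 1) = orderedProd (fun i => K (i + 1)) j * K 0 := by
  induction j with
  | zero => simp [orderedProd]
  | succ j ih => rw [orderedProd, ih, orderedProd, Matrix.mul_assoc]

theorem orderedProd_add_of_periodic {K : ℕ → Matrix (Fin 2) (Fin 2) R} {N : ℕ}
    (hK : ∀ j, K (j + N) = K j) (j : ℕ) :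
    orderedProd K (j + N) = orderedProd K j * orderedProd K N := by
  induction j with
  | zero => simp [orderedProd]
  | succ j ih =>
    rw [show j + 1 + N = (j + N) + 1 by ring, orderedProd, ih, hK, orderedProd, Matrix.mul_assoc]

theorem det_orderedProd (K : ℕ → Matrix (Fin 2) (Fin 2) R) (j : ℕ) :
    (orderedProd K j).det = ∏ i ∈ Finset.range j, (K i).det := by
  induction j with
  | zero => simp [orderedProd]
  | succ j ih => rw [orderedProd, Matrix.det_mul, ih, Finset.prod_range_succ, mul_comm]

/-- The columns are the solutions with initial data (1, 0) and (0, 1). One step sends the latter to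
(-w 0, 0), whence the shifted continuant. -/
theorem orderedProd_companion (x w : ℕ → R) (j : ℕ) :
    orderedProd (fun i => !![x i, -w i; 1, 0]) (j + 1) =
      !![continuant x w (j + 2),
          -(w 0 * continuant (fun i => x (i + 1)) (fun i => w (i + 1)) (j + 1));
        continuant x w (j + 1),
          -(w 0 * continuant (fun i => x (i + 1)) (fun i => w (i + 1)) j)] := by
  induction j with
  | zero => simp [orderedProd, continuant]
  | succ j ih =>
    rw [orderedProd, ih]
    ext a b
    fin_cases a <;> fin_cases b <;> simp [continuant, Matrix.mul_apply] <;> ring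

theorem trace_orderedProd_companion (x w : ℕ → R) (M : ℕ) :
    (orderedProd (fun i => !![x i, -w i; 1, 0]) (M + 1)).trace = cyclicTrace x w M := by
  rw [orderedProd_companion, Matrix.trace_fin_two, cyclicTrace]
  simp [sub_eq_add_neg]

theorem cyclicTrace_shift {x w : ℕ → R} {M : ℕ} (hx : x (M + 1) = x 0) (hw : w (M + 1) = w 0) :
    cyclicTrace (fun i => x (i + 1)) (fun i => w (i + 1)) M = cyclicTrace x w M := by
  rw [← trace_orderedProd_companion, ← trace_orderedProd_companion, orderedProd, hx, hw,
    Matrix.trace_mul_comm,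
    orderedProd_succ' (fun i => !![x i, -w i; 1, 0]) M]

/-- A division-free form of (α^j - β^j)/(α - β), valid also when α = β. -/
theorem continuant_const_succ (α β : R) (j : ℕ) :
    continuant (fun _ => α + β) (fun _ => α * β) (j + 1) =
      α * continuant (fun _ => α + β) (fun _ => α * β) j + β ^ j := by
  induction j with
  | zero => simp [continuant]
  | succ j ih =>
    rw [continuant, ih]; ring

theorem continuant_const_comm (α β : R) (j : ℕ) :
    continuant (fun _ => α + β) (fun _ => α * β) j =
      continuant (fun _ => β + α) (fun _ => β * α) j := by
  rw [add_comm, mul_comm]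

theorem cyclicTrace_const (α β : R) (M : ℕ) :
    cyclicTrace (fun _ => α + β) (fun _ => α * β) M = α ^ (M + 1) + β ^ (M + 1) := by
  have h1 := continuant_const_succ α β (M + 1)
  have h2 := continuant_const_succ β α M
  rw [← continuant_const_comm α β, ← continuant_const_comm α β] at h2
  rw [cyclicTrace, h1, h2]; ring

theorem natDegree_continuant_le {x w : ℕ → R[X]} {n : ℕ} (hx : ∀ j, (x j).natDegree ≤ n)
    (hw : ∀ j, (w j).natDegree ≤ n + n) : ∀ j, (continuant x w (j + 1)).natDegree ≤ j * n
  | 0 => by simp [continuant]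
  | 1 => by simpa [continuant] using hx 0
  | j + 2 => by
      have h1 := natDegree_continuant_le hx hw (j + 1)
      have h2 := natDegree_continuant_le hx hw j
      rw [continuant]
      refine (natDegree_sub_le _ _).trans (max_le ?_ ?_)
      · exact natDegree_mul_le.trans ((add_le_add (hx _) h1).trans (by ring_nf; rfl))
      · exact natDegree_mul_le.trans ((add_le_add (hw _) h2).trans (by ring_nf; rfl))

/-- In the expansion of a continuant, `w (j + 1)` replaces the pair `x j * x (j + 1)` and carries
the same power of `c`. Every term thus has the common factor with exponent ∑ (i + k), and what
remains has constant coefficients. The offset `k` serves the shifted continuant in `cyclicTrace`. -/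
theorem coeff_continuant {x w : ℕ → R[X]} {n k : ℕ} {α β c : R}
    (hx : ∀ j, (x j).natDegree ≤ n) (hw : ∀ j, (w j).natDegree ≤ n + n)
    (hxc : ∀ j, (x j).coeff n = (α + β) * c ^ (j + k))
    (hwc : ∀ j, (w (j + 1)).coeff (n + n) = α * β * c ^ (2 * j + 1 + 2 * k)) :
    ∀ j, (continuant x w (j + 1)).coeff (j * n) =
      c ^ (j.choose 2 + k * j) * continuant (fun _ => α + β) (fun _ => α * β) (j + 1)
  | 0 => by simp [continuant]
  | 1 => by simp [continuant, hxc]; ring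
  | j + 2 => by
      have h1 := coeff_continuant hx hw hxc hwc (j + 1)
      have h2 := coeff_continuant hx hw hxc hwc j
      have d1 := natDegree_continuant_le hx hw (j + 1)
      have d2 := natDegree_continuant_le hx hw j
      have e1 : (j + 2) * n = n + (j + 1) * n := by ring
      have e2 : (j + 2) * n = (n + n) + j * n := by ring
      rw [continuant, coeff_sub]
      nth_rw 1 [e1]
      rw [e2, coeff_mul_add_eq_of_natDegree_le (hx _) d1,
        coeff_mul_add_eq_of_natDegree_le (hw _) d2, h1, h2, hxc, hwc]
      have c1 : (j + 1).choose 2 = j + j.choose 2 := by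
        rw [Nat.choose_succ_succ' j 1, Nat.choose_one_right]
      have c2 : (j + 2).choose 2 = (j + 1) + (j + j.choose 2) := by
        rw [Nat.choose_succ_succ' (j + 1) 1, Nat.choose_one_right, c1]
      have c3 : continuant (fun _ => α + β) (fun _ => α * β) (j + 2 + 1) =
          (α + β) * continuant (fun _ => α + β) (fun _ => α * β) (j + 1 + 1)
            - α * β * continuant (fun _ => α + β) (fun _ => α * β) (j + 1) := rfl
      rw [c1, c2, c3]
      ring

theorem natDegree_cyclicTrace_le {x w : ℕ → R[X]} {n M : ℕ} (hx : ∀ j, (x j).natDegree ≤ n)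
    (hw : ∀ j, (w j).natDegree ≤ n + n) : (cyclicTrace x w M).natDegree ≤ (M + 1) * n := by
  rw [cyclicTrace]
  refine (natDegree_sub_le _ _).trans (max_le (natDegree_continuant_le hx hw (M + 1)) ?_)
  rcases M with _ | M
  · simp [continuant]
  · have := natDegree_continuant_le (fun j => hx (j + 1)) (fun j => hw (j + 1)) M
    exact natDegree_mul_le.trans ((add_le_add (hw _) this).trans (by ring_nf; rfl))

/-- The power counting of `coeff_continuant` also closes around the cycle: `w 0` replaces the pair
`x M * x 0`, consistently because c^(M+1) = 1. -/
theorem coeff_cyclicTrace {x w : ℕ → R[X]} {n M : ℕ} {α β c : R}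
    (hx : ∀ j, (x j).natDegree ≤ n) (hw : ∀ j, (w j).natDegree ≤ n + n)
    (hc : c ^ (M + 1) = 1)
    (hxc : ∀ j, (x j).coeff n = (α + β) * c ^ j)
    (hwc : ∀ j, c * (w j).coeff (n + n) = α * β * c ^ (2 * j)) :
    (cyclicTrace x w M).coeff ((M + 1) * n) =
      c ^ ((M + 1).choose 2) * (α ^ (M + 1) + β ^ (M + 1)) := by
  -- Here `c ^ M` acts as the inverse of `c`.
  have hw0 : (w 0).coeff (n + n) = α * β * c ^ M := by
    calc (w 0).coeff (n + n) = c ^ (M + 1) * (w 0).coeff (n + n) := by rw [hc, one_mul]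
      _ = c ^ M * (c * (w 0).coeff (n + n)) := by ring
      _ = _ := by rw [hwc]; ring
  have hws : ∀ j, (w (j + 1)).coeff (n + n) = α * β * c ^ (2 * j + 1) := fun j => by
    calc (w (j + 1)).coeff (n + n) = c ^ (M + 1) * (w (j + 1)).coeff (n + n) := by
          rw [hc, one_mul]
      _ = c ^ M * (c * (w (j + 1)).coeff (n + n)) := by ring
      _ = c ^ (M + 1) * (α * β * c ^ (2 * j + 1)) := by rw [hwc]; ring
      _ = _ := by rw [hc, one_mul]
  have h1 := coeff_continuant (k := 0) hx hw (by simpa using hxc) (by simpa using hws) (M + 1)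
  rw [cyclicTrace, coeff_sub, h1, ← cyclicTrace_const, cyclicTrace]
  rcases M with _ | M
  · simp [continuant]
  · have h2 := coeff_continuant (k := 1) (fun j => hx (j + 1)) (fun j => hw (j + 1))
      (fun j => hxc (j + 1)) (fun j => by rw [hws]; ring) M
    have d2 := natDegree_continuant_le (fun j => hx (j + 1)) (fun j => hw (j + 1)) M
    have e2 : (M + 1 + 1) * n = (n + n) + M * n := by ring
    have c1 : (M + 1 + 1).choose 2 = M + 1 + (M + M.choose 2) := by
      rw [Nat.choose_succ_succ' (M + 1) 1, Nat.choose_succ_succ' M 1, Nat.choose_one_right,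
        Nat.choose_one_right]
    nth_rw 1 [e2]
    rw [coeff_mul_add_eq_of_natDegree_le (hw _) d2, h2, hw0, c1]
    ring

/-- Invariance multiplies the i-th coefficient by ζ^i, so only coefficients with N ∣ i survive. -/
theorem exists_expand_of_comp_eq {K : Type*} [Field K] {N : ℕ} (hN : 0 < N) {ζ : K}
    (hζ : IsPrimitiveRoot ζ N) {f : K[X]} (hf : f.comp (C ζ * X) = f) :
    f = expand K N (contract N f) := by
  ext i
  rw [coeff_expand hN]
  split_ifs with h
  · rw [coeff_contract hN.ne', Nat.div_mul_cancel h]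
  · have h1 : f.coeff i * ζ ^ i = f.coeff i := by
      rw [← comp_C_mul_X_coeff, hf]
    by_contra h2
    exact h (hζ.dvd_of_pow_eq_one i (mul_left_cancel₀ h2 (by rw [h1, mul_one])))

theorem natDegree_contract_le_of_le {N n : ℕ} (hN : 0 < N) {f : R[X]}
    (hf : f.natDegree ≤ N * n) : (contract N f).natDegree ≤ n := by
  rw [natDegree_le_iff_coeff_eq_zero]
  intro i hi
  rw [coeff_contract hN.ne']
  apply coeff_eq_zero_of_natDegree_lt
  calc f.natDegree ≤ N * n := hf
    _ < N * i := Nat.mul_lt_mul_of_pos_left hi hN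
    _ = i * N := mul_comm _ _

end General

/-! ### Solvability of a three-term system on ℤ/N -/

section CyclicSystem

variable {K : Type*} [Field K] {N : ℕ} [NeZero N]

/-- One step of the recursion `x j * p j = u j * p (j - 1) + v j * p (j + 1)`. -/
def stepMatrix (x u v : ℕ → K) (j : ℕ) : Matrix (Fin 2) (Fin 2) K :=
  !![x j / v j, -(u j / v j); 1, 0]

/-- Since `v` never vanishes, (q 0, q (-1)) determines `q` by forward propagation; periodicity says
that this vector is fixed by the monodromy. -/
theorem exists_cyclic_solution_iff_det {x u v : ZMod N → K}
    (hv : ∀ γ, v γ ≠ 0) :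
    (∃ q : ZMod N → K, q ≠ 0 ∧ ∀ γ, x γ * q γ = u γ * q (γ - 1) + v γ * q (γ + 1)) ↔
      (orderedProd (stepMatrix (fun j => x j) (fun j => u j) (fun j => v j)) N - 1).det = 0 := by
  set A := stepMatrix (fun j => x (j : ZMod N)) (fun j => u j) (fun j => v j) with hA
  have hper : ∀ j, A (j + N) = A j := fun j => by simp [hA, stepMatrix]
  rw [← Matrix.exists_mulVec_eq_zero_iff]
  constructor
  · rintro ⟨q, hq0, hq⟩
    have key : ∀ j : ℕ, (orderedProd A j).mulVec ![q 0, q (-1)] = ![q j, q ((j : ZMod N) - 1)] := by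
      intro j
      induction j with
      | zero => simp [orderedProd]
      | succ j ih =>
        rw [orderedProd, ← Matrix.mulVec_mulVec, ih]
        have hj := hq (j : ZMod N)
        ext i
        fin_cases i
        · simp [hA, stepMatrix, Matrix.mulVec, dotProduct]
          field_simp [hv (j : ZMod N)]
          rw [hj]; ring
        · simp [hA, stepMatrix, Matrix.mulVec, dotProduct]
    refine ⟨![q 0, q (-1)], fun h => hq0 ?_, ?_⟩
    · funext γ
      have := congrFun (key γ.val) 0
      rw [h] at this
      simpa using this.symm
    · rw [Matrix.sub_mulVec, key N]
      simp
  · rintro ⟨e, he0, he⟩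
    rw [Matrix.sub_mulVec, Matrix.one_mulVec, sub_eq_zero] at he
    -- The propagated vector stands for (q j, q (j - 1)), so `p j` is q (j - 1); hence the shift in
    -- the witness `p (γ + 1).val` below.
    set p : ℕ → K := fun j => (orderedProd A j).mulVec e 1 with hp
    have hp1 : ∀ j, p (j + 1) = (orderedProd A j).mulVec e 0 := fun j => by
      simp only [hp]
      rw [orderedProd, ← Matrix.mulVec_mulVec]
      simp [hA, stepMatrix, Matrix.mulVec, dotProduct]
    have hp2 : ∀ j : ℕ, x (j : ZMod N) * p (j + 1) =
        u (j : ZMod N) * p j + v (j : ZMod N) * p (j + 2) := fun j => by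
      have h0 : (orderedProd A (j + 1)).mulVec e 0 =
          x j / v j * (orderedProd A j).mulVec e 0
            - u j / v j * (orderedProd A j).mulVec e 1 := by
        rw [orderedProd, ← Matrix.mulVec_mulVec]
        simp [hA, stepMatrix, Matrix.mulVec, dotProduct]
        ring
      rw [hp1 j, hp1 (j + 1), h0]
      simp only [hp]
      field_simp [hv (j : ZMod N)]
      ring
    have hpp : Function.Periodic p N := fun j => by
      simp only [hp]
      rw [orderedProd_add_of_periodic hper, ← Matrix.mulVec_mulVec, he]
    have hcast : ∀ j : ℕ, p (j : ZMod N).val = p j := fun j => by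
      rw [ZMod.val_natCast, hpp.map_mod_nat]
    refine ⟨fun γ => p (γ + 1).val, fun h => he0 ?_, fun γ => ?_⟩
    · ext i
      fin_cases i
      · have := congrFun h 0
        have h1 := hcast 1
        have h2 := hp1 0
        simp only [Nat.cast_one] at h1
        simp only [orderedProd, Matrix.one_mulVec] at h2
        simpa [h1, h2] using this
      · have := congrFun h (-1)
        have h1 := hcast 0
        simpa [hp, orderedProd] using this
    · have h1 : γ + 1 = ((γ.val + 1 : ℕ) : ZMod N) := by simp
      have h2 : γ + 1 + 1 = ((γ.val + 2 : ℕ) : ZMod N) := by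
        simp only [Nat.cast_add, ZMod.natCast_zmod_val, Nat.cast_ofNat]; ring
      have h3 := hp2 γ.val
      simp only [ZMod.natCast_zmod_val] at h3
      have h4 : p γ.val = p (γ - 1 + 1).val := by simp
      dsimp only
      rw [← h4, h2, h1, hcast, hcast]
      exact h3

/-- Rescaling solutions by the partial products of `v` clears denominators; `u` and `v` then enter
the recursion only through `w`. -/
theorem orderedProd_stepMatrix (x u v w : ℕ → K) (hv : ∀ j, v j ≠ 0)
    (hw : ∀ j, w (j + 1) = u (j + 1) * v j) (j : ℕ) :
    orderedProd (stepMatrix x u v) (j + 1) =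
      !![continuant x w (j + 2) / ∏ i ∈ Finset.range (j + 1), v i,
          -(u 0 * continuant (fun i => x (i + 1)) (fun i => w (i + 1)) (j + 1))
            / ∏ i ∈ Finset.range (j + 1), v i;
        continuant x w (j + 1) / ∏ i ∈ Finset.range j, v i,
          -(u 0 * continuant (fun i => x (i + 1)) (fun i => w (i + 1)) j)
            / ∏ i ∈ Finset.range j, v i] := by
  induction j with
  | zero => simp [orderedProd, continuant, stepMatrix, neg_div]
  | succ j ih =>
    rw [orderedProd, ih]
    have h0 := hv j
    have h1 := hv (j + 1)
    have h2 : ∏ i ∈ Finset.range j, v i ≠ 0 := Finset.prod_ne_zero_iff.mpr fun i _ => hv i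
    ext a b
    fin_cases a <;> fin_cases b <;>
      simp [continuant, Matrix.mul_apply, stepMatrix, Finset.prod_range_succ, hw] <;>
      field_simp <;> ring

/-- For a 2 × 2 matrix, det (A - 1) = 1 - tr A + det A; the trace and determinant of the monodromy
are then multiplied by ∏ v. -/
theorem exists_cyclic_solution_iff {M : ℕ} {x u v w : ZMod (M + 1) → K}
    (hv : ∀ γ, v γ ≠ 0) (hw : ∀ γ, w γ = u γ * v (γ - 1)) :
    (∃ q : ZMod (M + 1) → K, q ≠ 0 ∧ ∀ γ, x γ * q γ = u γ * q (γ - 1) + v γ * q (γ + 1)) ↔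
      cyclicTrace (fun j => x j) (fun j => w j) M =
        ∏ i ∈ Finset.range (M + 1), u (i : ZMod (M + 1))
          + ∏ i ∈ Finset.range (M + 1), v (i : ZMod (M + 1)) := by
  rw [exists_cyclic_solution_iff_det hv]
  have hV : ∏ i ∈ Finset.range (M + 1), v (i : ZMod (M + 1)) ≠ 0 :=
    Finset.prod_ne_zero_iff.mpr fun i _ => hv i
  have hV' : ∏ i ∈ Finset.range M, v (i : ZMod (M + 1)) ≠ 0 :=
    Finset.prod_ne_zero_iff.mpr fun i _ => hv i
  -- The wrap-around term: `w 0` involves `v (-1)`, the last factor of the product.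
  have hM : ((0 : ZMod (M + 1)) - 1) = (M : ZMod (M + 1)) := by
    have := ZMod.natCast_self (M + 1)
    push_cast at this
    linear_combination -this
  set A := orderedProd (stepMatrix (fun j => x (j : ZMod (M + 1))) (fun j => u j) (fun j => v j))
    (M + 1) with hA
  have hdet : A.det = (∏ i ∈ Finset.range (M + 1), u (i : ZMod (M + 1)))
      / ∏ i ∈ Finset.range (M + 1), v (i : ZMod (M + 1)) := by
    rw [hA, det_orderedProd, ← Finset.prod_div_distrib]
    exact Finset.prod_congr rfl fun i _ => by simp [stepMatrix, Matrix.det_fin_two]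
  have htr : A.trace = cyclicTrace (fun j => x j) (fun j => w j) M
      / ∏ i ∈ Finset.range (M + 1), v (i : ZMod (M + 1)) := by
    rw [hA, orderedProd_stepMatrix (fun j => x (j : ZMod (M + 1))) (fun j => u j) (fun j => v j)
      (fun j => w j) (fun j => hv j) (fun j => by simp [hw]) M, Matrix.trace_fin_two, cyclicTrace]
    have := hv M
    simp only [Matrix.of_apply, Matrix.cons_val', Matrix.cons_val_zero, Matrix.cons_val_one,
      Matrix.cons_val_fin_one, Nat.cast_zero, hw 0, hM]
    rw [Finset.prod_range_succ]
    field_simp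
    ring
  have hchar : (A - 1).det = 1 - A.trace + A.det := by
    simp [Matrix.det_fin_two, Matrix.trace_fin_two]; ring
  rw [hchar, htr, hdet]
  field_simp
  constructor
  · intro h; linear_combination -h
  · intro h; linear_combination -h

end CyclicSystem

end BBS
namespace BBS

open Polynomial

/-! ### Products over the powers of ω -/

section RootsOfUnity

variable {N : ℕ}

theorem isPrimitiveRoot_omega (hN : 0 < N) : IsPrimitiveRoot (omega N) N :=
  Complex.isPrimitiveRoot_exp N hN.ne'

theorem omega_pow_self (hN : 0 < N) : omega N ^ N = 1 := (isPrimitiveRoot_omega hN).pow_eq_one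

theorem omega_ne_zero (N : ℕ) : omega N ≠ 0 := Complex.exp_ne_zero _

theorem eps_mul_self (N : ℕ) : eps N * eps N = 1 := by
  rw [eps, ← mul_pow]; simp

theorem eps_ne_zero (N : ℕ) : eps N ≠ 0 := fun h => by simpa [h] using eps_mul_self N

theorem neg_pow_eq_eps (N : ℕ) (x : ℂ) : (-x) ^ N = eps N * x ^ N := by
  rw [neg_pow, eps]

theorem prod_sub_omega_pow_mul (hN : 0 < N) (x y : ℂ) :
    ∏ i ∈ Finset.range N, (x - omega N ^ i * y) = x ^ N - y ^ N := by
  classical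
  have h := isPrimitiveRoot_omega hN
  rw [h.pow_sub_pow_eq_prod_sub_mul x y hN]
  refine Finset.prod_bij (fun i _ => omega N ^ i) (fun i _ => ?_) (fun i hi j hj hij => ?_)
    (fun b hb => ?_) (fun i _ => rfl)
  · rw [Polynomial.mem_nthRootsFinset hN, ← pow_mul, mul_comm, pow_mul, h.pow_eq_one, one_pow]
  · exact h.pow_inj (Finset.mem_range.1 hi) (Finset.mem_range.1 hj) hij
  · have : NeZero N := ⟨hN.ne'⟩
    obtain ⟨i, hi, rfl⟩ := h.eq_pow_of_pow_eq_one ((Polynomial.mem_nthRootsFinset hN _).1 hb)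
    exact ⟨i, Finset.mem_range.2 hi, rfl⟩

theorem prod_add_mul_omega_pow (hN : 0 < N) (x y : ℂ) :
    ∏ i ∈ Finset.range N, (x + y * omega N ^ i) = x ^ N - eps N * y ^ N := by
  rw [← neg_pow_eq_eps, ← prod_sub_omega_pow_mul hN]
  exact Finset.prod_congr rfl fun i _ => by ring

theorem prod_omega_pow (hN : 0 < N) : ∏ i ∈ Finset.range N, omega N ^ i = -eps N := by
  have h := prod_add_mul_omega_pow hN 0 1
  simpa [zero_pow hN.ne'] using h

theorem prod_mul_omega_pow (hN : 0 < N) (x : ℂ) :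
    ∏ i ∈ Finset.range N, (omega N ^ i * x) = -eps N * x ^ N := by
  rw [Finset.prod_mul_distrib, prod_omega_pow hN]; simp

theorem omegaPow_natCast (hN : 0 < N) (j : ℕ) : omegaPow N (j : ZMod N) = omega N ^ j := by
  rw [omegaPow, ZMod.val_natCast, ← pow_eq_pow_mod j (omega_pow_self hN)]

theorem omegaPow_pow (hN : 0 < N) (ρ : ZMod N) : omegaPow N ρ ^ N = 1 := by
  rw [omegaPow, ← pow_mul, mul_comm, pow_mul, omega_pow_self hN, one_pow]

theorem omegaPow_ne_zero (ρ : ZMod N) : omegaPow N ρ ≠ 0 := pow_ne_zero _ (omega_ne_zero N)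

theorem omegaPow_add [NeZero N] (γ δ : ZMod N) :
    omegaPow N (γ + δ) = omegaPow N γ * omegaPow N δ := by
  have hN := NeZero.pos N
  rw [← ZMod.natCast_zmod_val γ, ← ZMod.natCast_zmod_val δ, ← Nat.cast_add,
    omegaPow_natCast hN, omegaPow_natCast hN, omegaPow_natCast hN, pow_add]

theorem omegaPow_neg [NeZero N] (γ : ZMod N) : omegaPow N (-γ) = (omegaPow N γ)⁻¹ := by
  refine eq_inv_of_mul_eq_one_left ?_
  rw [← omegaPow_add]
  simp [omegaPow]

end RootsOfUnity

/-! ### The fusion trace as a polynomial in λ^N -/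

section Trace

variable {N n : ℕ} {P : Params}

theorem tau_eq_continuant (ρ : ZMod N) (E : ℕ → ℂ) (lam : ℂ) : ∀ j,
    tau N n P ρ E j lam = continuant (fun i => t N n P ρ E (omega N ^ i * lam))
      (fun i => omegaPow N ρ * z N n P (omega N ^ i * lam)) j
  | 0 => rfl
  | 1 => rfl
  | 2 => by simp [tau, continuant]
  | j + 3 => by
      rw [tau, tau_eq_continuant ρ E lam (j + 2), tau_eq_continuant ρ E lam (j + 1)]
      rfl

/-- The left-hand side of the truncation identity, for a root of unity of order `M + 1`. -/
noncomputable def fusionTrace (M n : ℕ) (P : Params) (ρ : ZMod (M + 1)) (E : ℕ → ℂ)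
    (lam : ℂ) : ℂ :=
  cyclicTrace (fun i => t (M + 1) n P ρ E (omega (M + 1) ^ i * lam))
    (fun i => omegaPow (M + 1) ρ * z (M + 1) n P (omega (M + 1) ^ i * lam)) M

theorem tau_sub_eq_fusionTrace {M : ℕ} (ρ : ZMod (M + 1)) (E : ℕ → ℂ) (lam : ℂ) :
    tau (M + 1) n P ρ E (M + 1 + 1) lam - omegaPow (M + 1) ρ * z (M + 1) n P lam *
      tau (M + 1) n P ρ E M (omega (M + 1) * lam) = fusionTrace M n P ρ E lam := by
  rw [tau_eq_continuant, tau_eq_continuant, fusionTrace, cyclicTrace]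
  simp only [pow_zero, one_mul, pow_succ, mul_assoc]

/-- `t` as a polynomial. -/
noncomputable def tPoly (N n : ℕ) (P : Params) (ρ : ZMod N) (E : ℕ → ℂ) : ℂ[X] :=
  C (1 + omegaPow N ρ * ∏ m ∈ Finset.Icc 1 n, P.b m * P.d m / P.kap m)
    + ∑ j ∈ Finset.Icc 1 (n - 1), C (E j) * X ^ j
    + C (∏ m ∈ Finset.Icc 1 n, P.a m * P.c m
        + omegaPow N ρ * ∏ m ∈ Finset.Icc 1 n, P.kap m) * X ^ n

/-- `z` as a polynomial. -/
noncomputable def zPoly (N n : ℕ) (P : Params) : ℂ[X] :=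
  ∏ m ∈ Finset.Icc 1 n, (C (P.a m * P.kap m) * X + C (P.b m))
    * (C (P.c m / omega N) * X + C (P.d m / P.kap m))

theorem eval_tPoly (ρ : ZMod N) (E : ℕ → ℂ) (lam : ℂ) :
    (tPoly N n P ρ E).eval lam = t N n P ρ E lam := by
  simp only [tPoly, t, eval_add, eval_finsetSum, eval_mul, eval_C, eval_pow, eval_X]

theorem eval_zPoly (lam : ℂ) : (zPoly N n P).eval lam = z N n P lam := by
  rw [zPoly, z, eval_prod]
  refine Finset.prod_congr rfl fun m _ => ?_
  have := omega_ne_zero N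
  simp only [F, eval_mul, eval_add, eval_C, eval_X]
  field_simp
  ring

theorem natDegree_tPoly_le (ρ : ZMod N) (E : ℕ → ℂ) : (tPoly N n P ρ E).natDegree ≤ n := by
  refine natDegree_add_le_of_degree_le (natDegree_add_le_of_degree_le ?_ ?_)
    (natDegree_C_mul_X_pow_le _ _)
  · exact (natDegree_C _).trans_le (Nat.zero_le n)
  · refine natDegree_sum_le_of_forall_le _ _ fun j hj => ?_
    have := (Finset.mem_Icc.1 hj).2
    exact (natDegree_C_mul_X_pow_le _ _).trans (by omega)

theorem coeff_tPoly (hn : 1 ≤ n) (ρ : ZMod N) (E : ℕ → ℂ) :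
    (tPoly N n P ρ E).coeff n = ∏ m ∈ Finset.Icc 1 n, P.a m * P.c m
        + omegaPow N ρ * ∏ m ∈ Finset.Icc 1 n, P.kap m := by
  have h : ∑ j ∈ Finset.Icc 1 (n - 1), (C (E j) * X ^ j : ℂ[X]).coeff n = 0 :=
    Finset.sum_eq_zero fun j hj => by
      have := (Finset.mem_Icc.1 hj).2
      rw [coeff_C_mul_X_pow, if_neg (by omega)]
  rw [tPoly, coeff_add, coeff_add, finsetSum_coeff, h, coeff_C_mul_X_pow, if_pos rfl, coeff_C,
    if_neg (by omega)]
  ring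

theorem natDegree_zPoly_le_and_coeff : (zPoly N n P).natDegree ≤ n + n ∧
    (zPoly N n P).coeff (n + n) =
      ∏ m ∈ Finset.Icc 1 n, (P.a m * P.kap m) * (P.c m / omega N) := by
  induction n with
  | zero => simp [zPoly]
  | succ n ih =>
    have e : n + 1 + (n + 1) = (n + n) + (1 + 1) := by ring
    have h : zPoly N (n + 1) P = zPoly N n P *
        ((C (P.a (n + 1) * P.kap (n + 1)) * X + C (P.b (n + 1)))
          * (C (P.c (n + 1) / omega N) * X + C (P.d (n + 1) / P.kap (n + 1)))) := by
      rw [zPoly, Finset.prod_Icc_succ_top (by omega), zPoly]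
    have hd := natDegree_mul_le_of_le
      (natDegree_linear_le (a := P.a (n + 1) * P.kap (n + 1)) (b := P.b (n + 1)))
      (natDegree_linear_le (a := P.c (n + 1) / omega N) (b := P.d (n + 1) / P.kap (n + 1)))
    rw [h, e]
    refine ⟨natDegree_mul_le_of_le ih.1 hd, ?_⟩
    rw [coeff_mul_add_eq_of_natDegree_le ih.1 hd, ih.2,
      coeff_mul_add_eq_of_natDegree_le natDegree_linear_le natDegree_linear_le,
      Finset.prod_Icc_succ_top (by omega)]
    simp [coeff_C]

theorem z_zero : z N n P 0 = ∏ m ∈ Finset.Icc 1 n, P.b m * P.d m / P.kap m := by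
  simp [z, F, mul_div_assoc]

theorem natDegree_comp_C_mul_X_le (f : ℂ[X]) (a : ℂ) : (f.comp (C a * X)).natDegree ≤ f.natDegree := by
  refine natDegree_comp_le.trans ?_
  have : (C a * X).natDegree ≤ 1 := by simpa using natDegree_C_mul_X_pow_le a 1
  exact (Nat.mul_le_mul_left _ this).trans_eq (mul_one _)

/-- At both ends of the degree range the recursion reduces to coefficients α + β and αβ: E_0 and E_n
are the sums, ω^ρ z supplies the products. The result is α^N + β^N, where ω^ρ disappears. -/
theorem exists_fusionTrace_poly {M : ℕ} (hn : 1 ≤ n) (ρ : ZMod (M + 1)) (E : ℕ → ℂ) :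
    ∃ g : ℂ[X], g.natDegree ≤ n ∧ (∀ lam, fusionTrace M n P ρ E lam = g.eval (lam ^ (M + 1))) ∧
      g.coeff 0 = 1 + (∏ m ∈ Finset.Icc 1 n, P.b m * P.d m / P.kap m) ^ (M + 1) ∧
      g.coeff n = (-eps (M + 1)) ^ n * ((∏ m ∈ Finset.Icc 1 n, P.a m * P.c m) ^ (M + 1)
        + (∏ m ∈ Finset.Icc 1 n, P.kap m) ^ (M + 1)) := by
  have hN : 0 < M + 1 := Nat.succ_pos M
  set ω := omega (M + 1) with hω
  set x : ℕ → ℂ[X] := fun j => (tPoly (M + 1) n P ρ E).comp (C (ω ^ j) * X) with hx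
  set w : ℕ → ℂ[X] := fun j =>
    C (omegaPow (M + 1) ρ) * (zPoly (M + 1) n P).comp (C (ω ^ j) * X) with hw
  set f := cyclicTrace x w M with hf
  have hω1 : ω ^ (M + 1) = 1 := omega_pow_self hN
  have hfe : ∀ lam, f.eval lam = fusionTrace M n P ρ E lam := fun lam => by
    rw [hf, ← coe_evalRingHom, cyclicTrace_map, fusionTrace]
    simp [hx, hw, hω, eval_comp, eval_tPoly, eval_zPoly]
  have hcomp : f.comp (C ω * X) = f := by
    rw [← coe_compRingHom_apply, hf, cyclicTrace_map]
    rw [← cyclicTrace_shift (x := x) (w := w) (M := M) (by simp only [hx, hω1, pow_zero])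
      (by simp only [hw, hω1, pow_zero])]
    simp [hx, hw, comp_assoc, pow_succ, mul_assoc]
  have hxd : ∀ j, (x j).natDegree ≤ n := fun j =>
    (natDegree_comp_C_mul_X_le _ _).trans (natDegree_tPoly_le ρ E)
  have hwd : ∀ j, (w j).natDegree ≤ n + n := fun j =>
    (natDegree_C_mul_le _ _).trans
      ((natDegree_comp_C_mul_X_le _ _).trans natDegree_zPoly_le_and_coeff.1)
  have hfd : f.natDegree ≤ (M + 1) * n := natDegree_cyclicTrace_le hxd hwd
  have hexp := exists_expand_of_comp_eq hN (isPrimitiveRoot_omega hN) hcomp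
  refine ⟨contract (M + 1) f, natDegree_contract_le_of_le hN hfd, fun lam => ?_, ?_, ?_⟩
  · rw [← hfe, ← expand_eval, ← hexp]
  · rw [coeff_contract hN.ne', zero_mul, coeff_zero_eq_eval_zero, hfe, fusionTrace]
    have h := cyclicTrace_const 1 (omegaPow (M + 1) ρ *
      ∏ m ∈ Finset.Icc 1 n, P.b m * P.d m / P.kap m) M
    rw [mul_pow, omegaPow_pow hN] at h
    have ht : t (M + 1) n P ρ E 0 = 1 + omegaPow (M + 1) ρ *
        ∏ m ∈ Finset.Icc 1 n, P.b m * P.d m / P.kap m := by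
      rw [t, Finset.sum_eq_zero fun j hj => ?_, zero_pow (by omega)]
      · ring
      · rw [zero_pow (Nat.one_le_iff_ne_zero.1 (Finset.mem_Icc.1 hj).1), mul_zero]
    simpa only [mul_zero, z_zero, ht, one_pow, one_mul] using h
  · rw [coeff_contract hN.ne', mul_comm]
    have h := coeff_cyclicTrace (x := x) (w := w) (n := n) (M := M)
      (α := ∏ m ∈ Finset.Icc 1 n, P.a m * P.c m)
      (β := omegaPow (M + 1) ρ * ∏ m ∈ Finset.Icc 1 n, P.kap m) (c := ω ^ n) hxd hwd
      (by rw [← pow_mul, mul_comm, pow_mul, hω1, one_pow])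
      (fun j => by
        simp only [hx]
        rw [comp_C_mul_X_coeff, coeff_tPoly hn]; ring)
      (fun j => by
        simp only [hw]
        rw [coeff_C_mul, comp_C_mul_X_coeff, natDegree_zPoly_le_and_coeff.2]
        -- The argument λ/ω in z leaves one factor 1/ω per site, cancelled by the extra `c` = ω^n in
        -- the hypothesis of `coeff_cyclicTrace`.
        have h1 : ∏ m ∈ Finset.Icc 1 n, (P.a m * P.kap m) * (P.c m / omega (M + 1)) =
            ((∏ m ∈ Finset.Icc 1 n, P.a m * P.c m) * ∏ m ∈ Finset.Icc 1 n, P.kap m) / ω ^ n := by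
          rw [← Finset.prod_mul_distrib]
          have : ω ^ n = ∏ m ∈ Finset.Icc 1 n, ω := by simp
          rw [this, ← Finset.prod_div_distrib]
          exact Finset.prod_congr rfl fun m _ => by ring
        rw [h1]
        have : ω ^ n ≠ 0 := pow_ne_zero _ (omega_ne_zero _)
        field_simp
        ring)
    -- The prefactor ω^(n · N(N-1)/2) is (∏ ω^i)^n = (-ε)^n.
    rw [h, mul_pow (omegaPow (M + 1) ρ), omegaPow_pow hN, one_mul, ← prod_omega_pow hN,
      Finset.prod_pow_eq_pow_sum, ← pow_mul, ← pow_mul, Finset.sum_range_id, Nat.choose_two_right,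
      mul_comm n]

end Trace

/-! ### The classical monodromy and reduction to n - 1 points -/

section Classical

variable {N n : ℕ} {P : Params}

theorem det_classicalL {m : ℕ} (hk : P.kap m ≠ 0) (Lam : ℂ) :
    (classicalL N P m Lam).det = (P.b m ^ N - eps N * (P.a m * P.kap m) ^ N * Lam)
      * ((P.d m / P.kap m) ^ N - eps N * P.c m ^ N * Lam) := by
  rw [classicalL, Matrix.det_fin_two_of]
  have := pow_ne_zero N hk
  have he := eps_mul_self N
  rw [mul_pow, div_pow]
  field_simp
  ring

theorem prod_F (hN : 0 < N) {m : ℕ} (hk : P.kap m ≠ 0) (lam : ℂ) :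
    ∏ i ∈ Finset.range N, F N P m (omega N ^ i * lam) = (classicalL N P m (lam ^ N)).det := by
  rw [det_classicalL hk]
  simp only [F]
  have h1 := prod_add_mul_omega_pow hN (P.b m) (omega N * P.a m * P.kap m * lam)
  have h2 := prod_add_mul_omega_pow hN (P.d m / P.kap m) (P.c m * lam)
  rw [Finset.prod_mul_distrib]
  have e1 : ∀ i, P.b m + omega N * P.a m * P.kap m * (omega N ^ i * lam) =
    P.b m + omega N * P.a m * P.kap m * lam * omega N ^ i := fun i => by ring
  have e2 : ∀ i, omega N ^ i * lam * P.c m + P.d m / P.kap m =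
    P.d m / P.kap m + P.c m * lam * omega N ^ i := fun i => by ring
  simp only [e1, e2]
  rw [h1, h2]
  simp only [mul_pow, omega_pow_self hN]
  ring

theorem det_classicalT (m : ℕ) (Lam : ℂ) :
    (classicalT N P m Lam).det = ∏ k ∈ Finset.Icc 1 m, (classicalL N P k Lam).det := by
  induction m with
  | zero => simp [classicalT]
  | succ m ih => rw [classicalT, Matrix.det_mul, ih, Finset.prod_Icc_succ_top (by omega)]

/-- The classical monodromy with polynomial entries. -/
noncomputable def polyT (N : ℕ) (P : Params) : ℕ → Matrix (Fin 2) (Fin 2) ℂ[X]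
  | 0 => 1
  | m + 1 => polyT N P m *
      !![C (-(eps N * P.kap (m + 1) ^ N)) * X + C 1,
          C (-(eps N * (P.a (m + 1) ^ N - P.b (m + 1) ^ N))) * X + C 0;
        C 0 * X + C (P.c (m + 1) ^ N - P.d (m + 1) ^ N),
          C (-(eps N * P.a (m + 1) ^ N * P.c (m + 1) ^ N)) * X
            + C (P.b (m + 1) ^ N * P.d (m + 1) ^ N / P.kap (m + 1) ^ N)]

theorem eval_polyT (Lam : ℂ) (m : ℕ) : ∀ i j, (polyT N P m i j).eval Lam =
    classicalT N P m Lam i j := by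
  induction m with
  | zero => intro i j; fin_cases i <;> fin_cases j <;> simp [polyT, classicalT]
  | succ m ih =>
    intro i j
    rw [polyT, classicalT, classicalL, Matrix.mul_apply, Matrix.mul_apply, Fin.sum_univ_two,
      Fin.sum_univ_two, eval_add, eval_mul, eval_mul, ih, ih]
    fin_cases j <;>
      simp only [Matrix.of_apply, Matrix.cons_val', Matrix.cons_val_zero, Matrix.cons_val_one,
        Matrix.cons_val_fin_one, eval_add, eval_mul, eval_C, eval_X, Fin.zero_eta, Fin.mk_one] <;>
      ring

theorem natDegree_polyT_le (m : ℕ) : ∀ i j, (polyT N P m i j).natDegree ≤ m := by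
  induction m with
  | zero => intro i j; fin_cases i <;> fin_cases j <;> simp [polyT]
  | succ m ih =>
    intro i j
    rw [polyT, Matrix.mul_apply, Fin.sum_univ_two]
    refine natDegree_add_le_of_degree_le (natDegree_mul_le_of_le (ih _ _) ?_)
      (natDegree_mul_le_of_le (ih _ _) ?_) <;> fin_cases j <;> exact natDegree_linear_le

/-- The Λ-coefficient of each 𝓛 is upper triangular, so the diagonal entries multiply. -/
theorem coeff_polyT (m : ℕ) : (polyT N P m 1 0).coeff m = 0 ∧
    (polyT N P m 0 0).coeff m = (-eps N) ^ m * (∏ k ∈ Finset.Icc 1 m, P.kap k) ^ N ∧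
    (polyT N P m 1 1).coeff m = (-eps N) ^ m * (∏ k ∈ Finset.Icc 1 m, P.a k * P.c k) ^ N := by
  induction m with
  | zero => simp [polyT]
  | succ m ih =>
    obtain ⟨h1, h2, h3⟩ := ih
    have hd := natDegree_polyT_le (N := N) (P := P) m
    have key : ∀ (i k : Fin 2) (a b : ℂ),
        (polyT N P m i k * (C a * X + C b)).coeff (m + 1) = (polyT N P m i k).coeff m * a :=
      fun i k a b => by
        rw [coeff_mul_add_eq_of_natDegree_le (hd i k) natDegree_linear_le]
        simp [coeff_C]
    refine ⟨?_, ?_, ?_⟩ <;>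
      rw [polyT, Matrix.mul_apply, Fin.sum_univ_two, coeff_add] <;>
      simp only [Matrix.of_apply, Matrix.cons_val', Matrix.cons_val_zero, Matrix.cons_val_one,
        Matrix.cons_val_fin_one, key, h1, h2, h3] <;>
      (try rw [Finset.prod_Icc_succ_top (by omega)]) <;> ring

/-- At Λ = 0 each 𝓛 is lower triangular. -/
theorem classicalT_zero (m : ℕ) : classicalT N P m 0 0 1 = 0 ∧
    classicalT N P m 0 0 0 = 1 ∧
    classicalT N P m 0 1 1 = (∏ k ∈ Finset.Icc 1 m, P.b k * P.d k / P.kap k) ^ N := by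
  induction m with
  | zero => simp [classicalT]
  | succ m ih =>
    obtain ⟨h1, h2, h3⟩ := ih
    have hs := Finset.prod_Icc_succ_top (show 1 ≤ m + 1 by omega)
      (fun k => P.b k * P.d k / P.kap k)
    refine ⟨?_, ?_, ?_⟩ <;>
      simp only [classicalT, classicalL, Matrix.mul_apply, Fin.sum_univ_two, h1, h2, h3, hs,
        Matrix.of_apply, Matrix.cons_val', Matrix.cons_val_zero, Matrix.cons_val_one,
        Matrix.cons_val_fin_one] <;>
      ring

theorem fusionTrace_eq_iff {M : ℕ} (hn : 1 ≤ n) (ρ : ZMod (M + 1)) (E : ℕ → ℂ) {μ : ℕ → ℂ}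
    (hμ0 : ∀ k ∈ Finset.Icc 1 (n - 1), μ k ≠ 0)
    (hμ : ∀ k ∈ Finset.Icc 1 (n - 1), ∀ l ∈ Finset.Icc 1 (n - 1), k ≠ l →
      μ k ^ (M + 1) ≠ μ l ^ (M + 1)) :
    (∀ lam, fusionTrace M n P ρ E lam =
      classicalA (M + 1) P n (lam ^ (M + 1)) + classicalD (M + 1) P n (lam ^ (M + 1))) ↔
    ∀ k ∈ Finset.Icc 1 (n - 1), fusionTrace M n P ρ E (μ k) =
      classicalA (M + 1) P n (μ k ^ (M + 1)) + classicalD (M + 1) P n (μ k ^ (M + 1)) := by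
  refine ⟨fun h k _ => h (μ k), fun h => ?_⟩
  obtain ⟨g, hgd, hge, hg0, hgn⟩ := exists_fusionTrace_poly (P := P) hn ρ E
  set f := polyT (M + 1) P n 0 0 + polyT (M + 1) P n 1 1 with hf
  have hfe : ∀ Lam, f.eval Lam = classicalA (M + 1) P n Lam + classicalD (M + 1) P n Lam :=
    fun Lam => by rw [hf, eval_add, eval_polyT, eval_polyT, classicalA, classicalD]
  have hfd : f.natDegree ≤ n :=
    natDegree_add_le_of_degree_le (natDegree_polyT_le n _ _) (natDegree_polyT_le n _ _)
  have hfn : f.coeff n = g.coeff n := by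
    rw [hgn, hf, coeff_add, (coeff_polyT n).2.1, (coeff_polyT n).2.2]; ring
  have hf0 : f.eval 0 = g.eval 0 := by
    rw [← coeff_zero_eq_eval_zero g, hg0, hfe, classicalA, classicalD,
      (classicalT_zero n).2.1, (classicalT_zero n).2.2]
  have hdeg : (g - f).natDegree < n := by
    refine lt_of_le_of_ne ((natDegree_sub_le _ _).trans (max_le hgd hfd)) fun hd => ?_
    have hl : (g - f).leadingCoeff = 0 := by
      rw [leadingCoeff, hd, coeff_sub, hfn, sub_self]
    rw [leadingCoeff_eq_zero.1 hl, natDegree_zero] at hd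
    omega
  -- The difference has degree below n and n distinct zeros: index 0 stands for Λ = 0, the others
  -- for the `μ k ^ (M + 1)`.
  have hgf : g - f = 0 := by
    refine eq_zero_of_natDegree_lt_card_of_eval_eq_zero (g - f)
      (f := fun k : Fin n => if (k : ℕ) = 0 then 0 else μ k ^ (M + 1)) ?_ ?_ (by simpa using hdeg)
    · intro k l hkl
      have hmem : ∀ k : Fin n, (k : ℕ) ≠ 0 → (k : ℕ) ∈ Finset.Icc 1 (n - 1) := fun k hk => by
        have := k.2
        exact Finset.mem_Icc.2 ⟨by omega, by omega⟩
      dsimp only at hkl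
      split_ifs at hkl with h1 h2 h2
      · exact Fin.ext (h1.trans h2.symm)
      · exact absurd hkl.symm (pow_ne_zero _ (hμ0 _ (hmem l h2)))
      · exact absurd hkl (pow_ne_zero _ (hμ0 _ (hmem k h1)))
      · by_contra hne
        exact hμ _ (hmem k h1) _ (hmem l h2) (fun h => hne (Fin.ext h)) hkl
    · intro k
      have hk := k.2
      split_ifs with h1
      · rw [eval_sub, hf0, sub_self]
      · rw [eval_sub, ← hge, hfe, h _ (Finset.mem_Icc.2 ⟨by omega, by omega⟩), sub_self]
  intro lam
  rw [hge, sub_eq_zero.1 hgf, hfe]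

end Classical

end BBS
namespace BBS

/-! ### Orbit products of Δ_± and the Baxter systems -/

section Separation

variable {N n : ℕ} {P : Params}

theorem rTilde_pow (R : Amplitudes N n P) {m : ℕ} :
    rTilde R (m + 1) ^ N = R.r (m + 1) 0 ^ N * ∏ s ∈ Finset.Icc 1 m, R.r (m + 1) s ^ N := by
  rw [rTilde, ← Finset.prod_pow, Finset.prod_range_succ', mul_comm]
  congr 1
  have h : ∀ (f : ℕ → ℂ) (j : ℕ), ∏ s ∈ Finset.range j, f (s + 1) = ∏ s ∈ Finset.Icc 1 j, f s := by
    intro f j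
    induction j with
    | zero => simp
    | succ j ih => rw [Finset.prod_range_succ, ih, Finset.prod_Icc_succ_top (by omega)]
  exact h (fun s => R.r (m + 1) s ^ N) m

theorem y_pow (R : Amplitudes N n P) (hR : Generic N n P R) {m m' s s' : ℕ}
    (hm : m ∈ Finset.Icc 1 n) (hm' : m' ∈ Finset.Icc 1 n) (hs : s ∈ Finset.Icc 1 (m - 1))
    (hs' : s' ∈ Finset.Icc 1 (m' - 1)) :
    R.y m s m' s' ^ N = (R.r m' s' ^ N - R.r m s ^ N) / R.r m' s' ^ N := by
  have h := R.fermat m hm m' hm' s hs s' hs'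
  have h0 : R.r m' s' ^ N ≠ 0 := pow_ne_zero _ (hR.r_ne m' hm' s' (by
    simp only [Finset.mem_Icc] at hm' hs'
    exact Finset.mem_range.2 (by omega)))
  rw [div_pow] at h
  field_simp at h ⊢
  linear_combination h

/-- In the quotients of the `y` the antisymmetric differences cancel up to sign, and the two signs
(-1)^m compensate. The right side is, up to signs, 𝓑_{n-1}(Λ)/Λ at the k-th zero of 𝓑_n(Λ)/Λ. -/
theorem chi_pow {m : ℕ} (R : Amplitudes N (m + 2) P) (hR : Generic N (m + 2) P R) {k : ℕ}
    (hk : k ∈ Finset.Icc 1 (m + 1)) :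
    chi R k ^ N * (R.r (m + 2) k ^ N) ^ (m + 1) * R.site (m + 2) ^ N =
      R.r (m + 1) 0 ^ N * ∏ s ∈ Finset.Icc 1 m, (R.r (m + 2) k ^ N - R.r (m + 1) s ^ N) := by
  have hn : m + 2 ∈ Finset.Icc 1 (m + 2) := by simp
  have hn' : m + 1 ∈ Finset.Icc 1 (m + 2) := by simp
  have hp : ∀ s ∈ Finset.Icc 1 (m + 1), R.r (m + 2) s ^ N ≠ 0 := fun s hs =>
    pow_ne_zero _ (hR.r_ne _ hn s (Finset.mem_range.2 (by
      have := (Finset.mem_Icc.1 hs).2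
      omega)))
  have hp' : ∀ s ∈ Finset.Icc 1 m, R.r (m + 1) s ^ N ≠ 0 := fun s hs =>
    pow_ne_zero _ (hR.r_ne _ hn' s (Finset.mem_range.2 (by
      have := (Finset.mem_Icc.1 hs).2
      omega)))
  have h0 : R.r (m + 2) 0 ^ N ≠ 0 := pow_ne_zero _ (hR.r_ne _ hn 0 (by simp))
  have hsite : R.site (m + 2) ^ N ≠ 0 := pow_ne_zero _ (hR.site_ne _ hn)
  have hcard : ((Finset.Icc 1 (m + 1)).erase k).card = m := by
    rw [Finset.card_erase_of_mem hk]; simp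
  have e1 : ∏ s ∈ (Finset.Icc 1 (m + 1)).erase k,
      (R.y (m + 2) s (m + 2) k / R.y (m + 2) k (m + 2) s) ^ N =
      (-1) ^ m * (∏ s ∈ (Finset.Icc 1 (m + 1)).erase k, R.r (m + 2) s ^ N)
        / (R.r (m + 2) k ^ N) ^ m := by
    calc _ = ∏ s ∈ (Finset.Icc 1 (m + 1)).erase k,
        (-1 * R.r (m + 2) s ^ N / R.r (m + 2) k ^ N) := by
          refine Finset.prod_congr rfl fun s hs => ?_
          obtain ⟨hsk, hs⟩ := Finset.mem_erase.1 hs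
          rw [div_pow, y_pow R hR hn hn hs hk, y_pow R hR hn hn hk hs]
          have h1 := hp s hs
          have h2 := hp k hk
          have h3 : R.r (m + 2) s ^ N - R.r (m + 2) k ^ N ≠ 0 :=
            sub_ne_zero.2 (hR.simple _ hn s hs k hk hsk)
          field_simp
          ring
      _ = _ := by
          rw [Finset.prod_div_distrib, Finset.prod_mul_distrib, Finset.prod_const,
            Finset.prod_const, hcard]
  have e2 : ∏ s ∈ Finset.Icc 1 m, R.y (m + 2) k (m + 1) s ^ N =
      (-1) ^ m * (∏ s ∈ Finset.Icc 1 m, (R.r (m + 2) k ^ N - R.r (m + 1) s ^ N))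
        / ∏ s ∈ Finset.Icc 1 m, R.r (m + 1) s ^ N := by
    calc _ = ∏ s ∈ Finset.Icc 1 m,
        (-1 * (R.r (m + 2) k ^ N - R.r (m + 1) s ^ N) / R.r (m + 1) s ^ N) :=
          Finset.prod_congr rfl fun s hs => by
            rw [y_pow R hR hn hn' hk hs]; ring
      _ = _ := by
          rw [Finset.prod_div_distrib, Finset.prod_mul_distrib, Finset.prod_const]
          simp
  have e3 := Finset.mul_prod_erase (Finset.Icc 1 (m + 1)) (fun s => R.r (m + 2) s ^ N) hk
  have e4 : ∏ s ∈ Finset.Icc 1 m, R.r (m + 1) s ^ N ≠ 0 := Finset.prod_ne_zero_iff.2 hp'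
  have e5 : ∏ s ∈ (Finset.Icc 1 (m + 1)).erase k, R.r (m + 2) s ^ N ≠ 0 :=
    Finset.prod_ne_zero_iff.2 fun s hs => hp s (Finset.mem_of_mem_erase hs)
  have e6 := hp k hk
  have e7 : ((-1 : ℂ) ^ m) * (-1) ^ m = 1 := by rw [← mul_pow]; simp
  simp only [chi, show m + 2 - 1 = m + 1 by omega, show m + 2 - 2 = m by omega]
  rw [mul_pow, mul_pow, div_pow, mul_pow, mul_pow, rTilde_pow, rTilde_pow, ← Finset.prod_pow,
    ← Finset.prod_pow, e1, e2, ← e3]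
  set a := ∏ s ∈ Finset.Icc 1 m, R.r (m + 1) s ^ N
  set b := ∏ s ∈ (Finset.Icc 1 (m + 1)).erase k, R.r (m + 2) s ^ N
  set c := ∏ s ∈ Finset.Icc 1 m, (R.r (m + 2) k ^ N - R.r (m + 1) s ^ N)
  generalize R.r (m + 2) k ^ N = p at *
  field_simp
  linear_combination R.r (m + 1) 0 ^ N * c * p ^ (m + 1) * e7

/-- Multiply the row (𝓐, 0) = (𝓐', 𝓑') 𝓛 by the adjugate of 𝓛 and compare second entries. -/
theorem classicalA_mul_of_classicalB_eq_zero {m : ℕ} {Lam : ℂ}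
    (hB : classicalB N P (m + 1) Lam = 0) :
    classicalA N P (m + 1) Lam * (eps N * Lam * (P.a (m + 1) ^ N - P.b (m + 1) ^ N)) =
      classicalB N P m Lam * (classicalL N P (m + 1) Lam).det := by
  simp only [classicalA, classicalB, classicalT, Matrix.mul_apply, Fin.sum_univ_two,
    Matrix.det_fin_two] at hB ⊢
  have h01 : classicalL N P (m + 1) Lam 0 1 =
    -(eps N * Lam * (P.a (m + 1) ^ N - P.b (m + 1) ^ N)) := by simp [classicalL]
  rw [← neg_eq_iff_eq_neg] at h01
  rw [← h01]
  linear_combination -classicalL N P (m + 1) Lam 0 0 * hB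

theorem classicalB_root (R : Amplitudes N n P) {k : ℕ}
    (hk : k ∈ Finset.Icc 1 (n - 1)) : classicalB N P n (eps N * R.r n k ^ N) = 0 := by
  have hn : n ∈ Finset.Icc 1 n := by
    simp only [Finset.mem_Icc] at hk ⊢
    omega
  rw [R.factor_B n hn, Finset.prod_eq_zero hk (sub_self _), mul_zero]

theorem classicalA_mul_classicalD (R : Amplitudes N n P) {k : ℕ}
    (hk : k ∈ Finset.Icc 1 (n - 1)) :
    classicalA N P n (eps N * R.r n k ^ N) * classicalD N P n (eps N * R.r n k ^ N) =
      (classicalT N P n (eps N * R.r n k ^ N)).det := by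
  have h := classicalB_root R hk
  rw [classicalB] at h
  rw [Matrix.det_fin_two, h, classicalA, classicalD]; ring

theorem prod_DeltaMinus {m : ℕ} (hN : 0 < N) (R : Amplitudes N (m + 2) P)
    (hR : Generic N (m + 2) P R) {k : ℕ} (lam : ℂ) :
    ∏ i ∈ Finset.range N, DeltaMinus R k (omega N * (omega N ^ i * lam)) =
      chi R k ^ N * (-eps N * lam ^ N) ^ (m + 1) * (classicalL N P (m + 2) (lam ^ N)).det := by
  have h : ∀ i, DeltaMinus R k (omega N * (omega N ^ i * lam)) =
      chi R k * (omega N ^ i * lam) ^ (m + 1) * F N P (m + 2) (omega N ^ i * lam) := fun i => by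
    rw [DeltaMinus, mul_div_cancel_left₀ _ (omega_ne_zero N),
      show (((m + 2 : ℕ) : ℤ) - 1) = ((m + 1 : ℕ) : ℤ) by push_cast; ring, zpow_natCast]
  simp only [h]
  rw [Finset.prod_mul_distrib, Finset.prod_mul_distrib, prod_F hN (hR.kap_ne _ (by simp)),
    Finset.prod_pow, prod_mul_omega_pow hN]
  simp

theorem DeltaPlus_eq {m : ℕ} (R : Amplitudes N (m + 2) P) (ρ : ZMod N) (k : ℕ) (lam : ℂ) :
    DeltaPlus R ρ k lam = omegaPow N ρ / chi R k * ((lam / omega N) ^ (m + 1))⁻¹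
      * ∏ l ∈ Finset.Icc 1 (m + 1), F N P l (lam / omega N) := by
  rw [DeltaPlus, show (1 - ((m + 2 : ℕ) : ℤ)) = -((m + 1 : ℕ) : ℤ) by push_cast; ring,
    zpow_neg, zpow_natCast]
  simp

theorem DeltaPlus_mul_DeltaMinus {m : ℕ} (R : Amplitudes N (m + 2) P) (ρ : ZMod N) {k : ℕ}
    (hχ : chi R k ≠ 0) {lam : ℂ} (hl : lam ≠ 0) :
    DeltaPlus R ρ k lam * DeltaMinus R k lam = omegaPow N ρ * z N (m + 2) P lam := by
  have hl' : lam / omega N ≠ 0 := div_ne_zero hl (omega_ne_zero N)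
  rw [DeltaPlus_eq, DeltaMinus, z, Finset.prod_Icc_succ_top (show 1 ≤ m + 1 + 1 by omega),
    show (((m + 2 : ℕ) : ℤ) - 1) = ((m + 1 : ℕ) : ℤ) by push_cast; ring, zpow_natCast]
  field_simp

theorem prod_DeltaPlus {m : ℕ} (hN : 0 < N) (R : Amplitudes N (m + 2) P)
    (hR : Generic N (m + 2) P R) (ρ : ZMod N) {k : ℕ} (lam : ℂ) :
    ∏ i ∈ Finset.range N, DeltaPlus R ρ k (omega N ^ i * lam) =
      (chi R k ^ N)⁻¹ * ((-eps N * lam ^ N) ^ (m + 1))⁻¹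
        * ∏ l ∈ Finset.Icc 1 (m + 1), (classicalL N P l (lam ^ N)).det := by
  have hpow : (lam / omega N) ^ N = lam ^ N := by rw [div_pow, omega_pow_self hN, div_one]
  simp only [DeltaPlus_eq, mul_div_assoc]
  rw [Finset.prod_mul_distrib, Finset.prod_mul_distrib, Finset.prod_inv_distrib, Finset.prod_pow,
    prod_mul_omega_pow hN, Finset.prod_comm, hpow]
  congr 1
  · congr 1
    rw [Finset.prod_const, Finset.card_range, div_pow, omegaPow_pow hN, one_div]
  · refine Finset.prod_congr rfl fun l hl => ?_
    rw [prod_F hN (hR.kap_ne l ?_), hpow]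
    have := (Finset.mem_Icc.1 hl)
    exact Finset.mem_Icc.2 ⟨this.1, by omega⟩

/-- The Δ_- product comes from `chi_pow` and `classicalA_mul_of_classicalB_eq_zero`; the Δ_+ product
then follows from 𝓐𝓓 = det 𝓣 after cancelling 𝓐 ≠ 0. -/
theorem prod_Delta_eq {m : ℕ} (hN : 0 < N) (R : Amplitudes N (m + 2) P)
    (hR : Generic N (m + 2) P R) (ρ : ZMod N) {k : ℕ} (hk : k ∈ Finset.Icc 1 (m + 1)) :
    chi R k ≠ 0 ∧
    ∏ i ∈ Finset.range N, DeltaMinus R k (omega N * (omega N ^ i * -R.r (m + 2) k)) =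
      classicalA N P (m + 2) ((-R.r (m + 2) k) ^ N) ∧
    ∏ i ∈ Finset.range N, DeltaPlus R ρ k (omega N ^ i * -R.r (m + 2) k) =
      classicalD N P (m + 2) ((-R.r (m + 2) k) ^ N) := by
  have hn : m + 2 ∈ Finset.Icc 1 (m + 2) := by simp
  have hn' : m + 1 ∈ Finset.Icc 1 (m + 2) := by simp
  have hr : R.r (m + 2) k ≠ 0 := hR.r_ne _ hn k (Finset.mem_range.2 (by
    have := (Finset.mem_Icc.1 hk).2
    omega))
  have hp : R.r (m + 2) k ^ N ≠ 0 := pow_ne_zero _ hr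
  have hsite : R.site (m + 2) ^ N ≠ 0 := pow_ne_zero _ (hR.site_ne _ hn)
  have he := eps_ne_zero N
  have hee := eps_mul_self N
  have hdet := hR.det_ne k hk
  have hAD := classicalA_mul_classicalD R hk
  have hAB := classicalA_mul_of_classicalB_eq_zero (classicalB_root R hk)
  rw [← R.site_pow _ hn] at hAB
  have hχ := chi_pow R hR hk
  have hB := R.factor_B (m + 1) hn' (eps N * R.r (m + 2) k ^ N)
  have hprod : ∏ s ∈ Finset.Icc 1 (m + 1 - 1),
      (eps N * R.r (m + 2) k ^ N - eps N * R.r (m + 1) s ^ N) =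
      eps N ^ m * ∏ s ∈ Finset.Icc 1 m, (R.r (m + 2) k ^ N - R.r (m + 1) s ^ N) := by
    simp only [← mul_sub, Finset.prod_mul_distrib, Finset.prod_const, add_tsub_cancel_right,
      Nat.card_Icc]
  rw [hprod] at hB
  have hem : eps N ^ m * eps N ^ m = 1 := by rw [← mul_pow, hee, one_pow]
  rw [prod_DeltaMinus hN R hR, prod_DeltaPlus hN R hR, neg_pow_eq_eps]
  set p := R.r (m + 2) k ^ N
  set Lam := eps N * p with hLam
  have hA0 : classicalA N P (m + 2) Lam ≠ 0 := fun h => hdet (by rw [← hAD, h, zero_mul])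
  have hneg : -eps N * Lam = -p := by rw [hLam]; linear_combination -p * hee
  have hBχ : classicalB N P (m + 1) Lam =
      chi R k ^ N * (-p) ^ (m + 1) * (eps N * Lam * R.site (m + 2) ^ N) := by
    have h1 : (-eps N) ^ (m + 1) = (-1) ^ (m + 1) * eps N * eps N ^ m := by
      rw [neg_pow]; ring
    have h2 : (-p) ^ (m + 1) = (-1) ^ (m + 1) * p ^ (m + 1) := by rw [neg_pow]
    rw [hB, h1, h2]
    linear_combination (-1) ^ (m + 1) * eps N * Lam * (R.r (m + 1) 0 ^ N *
      ∏ s ∈ Finset.Icc 1 m, (p - R.r (m + 1) s ^ N)) * hem - (-1) ^ (m + 1) * eps N * Lam * hχ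
  have hA : chi R k ^ N * (-eps N * Lam) ^ (m + 1) * (classicalL N P (m + 2) Lam).det =
      classicalA N P (m + 2) Lam := by
    have hne : eps N * Lam * R.site (m + 2) ^ N ≠ 0 :=
      mul_ne_zero (mul_ne_zero he (mul_ne_zero he hp)) hsite
    refine mul_right_cancel₀ hne ?_
    rw [hAB, hBχ, hneg]; ring
  have hχ0 : chi R k ^ N ≠ 0 := fun h => hA0 (by rw [← hA, h]; ring)
  refine ⟨fun h => hχ0 (by rw [h, zero_pow hN.ne']), hA, ?_⟩
  refine mul_left_cancel₀ hA0 ?_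
  rw [hAD, det_classicalT, Finset.prod_Icc_succ_top (show 1 ≤ m + 1 + 1 by omega), ← hA, hneg]
  have : (-p) ^ (m + 1) ≠ 0 := pow_ne_zero _ (neg_ne_zero.2 hp)
  field_simp

theorem root_neg_natCast [NeZero N] (R : Amplitudes N n P) (k j : ℕ) :
    root R k (-(j : ZMod N)) = omega N ^ j * -R.r n k := by
  rw [root, omegaPow_neg, inv_inv, omegaPow_natCast (NeZero.pos N), mul_comm]

theorem omega_mul_root [NeZero N] (R : Amplitudes N n P) (k : ℕ) (γ : ZMod N) :
    omega N * root R k (γ + 1) = root R k γ := by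
  have h1 : omegaPow N (1 : ZMod N) = omega N := by
    simpa using omegaPow_natCast (NeZero.pos N) 1
  have := omega_ne_zero N
  have := omegaPow_ne_zero γ
  rw [root, root, omegaPow_add, h1]
  field_simp

/-- The reflection γ ↦ -γ turns the roots into ω^j · (-r_{n,k}), the order in which the fusion trace
runs, and makes Δ_+ the coefficient of q (γ - 1). -/
theorem exists_isBaxterSolution_iff {M m : ℕ} (R : Amplitudes (M + 1) (m + 2) P)
    (hR : Generic (M + 1) (m + 2) P R) (ρ : ZMod (M + 1)) (E : ℕ → ℂ) {k : ℕ}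
    (hk : k ∈ Finset.Icc 1 (m + 1)) :
    (∃ q : ZMod (M + 1) → ℂ, q ≠ 0 ∧ IsBaxterSolution R ρ E k q) ↔
      fusionTrace M (m + 2) P ρ E (-R.r (m + 2) k) =
        classicalA (M + 1) P (m + 2) ((-R.r (m + 2) k) ^ (M + 1))
          + classicalD (M + 1) P (m + 2) ((-R.r (m + 2) k) ^ (M + 1)) := by
  obtain ⟨hχ, hA, hD⟩ := prod_Delta_eq M.succ_pos R hR ρ hk
  have hr : R.r (m + 2) k ≠ 0 := hR.r_ne (m + 2) (by simp) k (Finset.mem_range.2 (by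
    have := (Finset.mem_Icc.1 hk).2
    omega))
  have hroot : ∀ γ, root R k γ ≠ 0 := fun γ =>
    mul_ne_zero (neg_ne_zero.2 hr) (inv_ne_zero (omegaPow_ne_zero γ))
  have hA0 : classicalA (M + 1) P (m + 2) ((-R.r (m + 2) k) ^ (M + 1)) ≠ 0 := fun h => by
    rw [neg_pow_eq_eps] at h
    exact hR.det_ne k hk (by rw [← classicalA_mul_classicalD R hk, h, zero_mul])
  -- The product of these values over the orbit is 𝓐_n, nonzero because det 𝓣_n = 𝓐_n 𝓓_n is.
  have hv : ∀ γ : ZMod (M + 1), DeltaMinus R k (omega (M + 1) * root R k (-γ)) ≠ 0 := fun γ => by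
    rw [← hA, Finset.prod_ne_zero_iff] at hA0
    rw [← ZMod.natCast_zmod_val γ, root_neg_natCast]
    exact hA0 _ (Finset.mem_range.2 (ZMod.val_lt γ))
  have hw : ∀ γ : ZMod (M + 1),
      omegaPow (M + 1) ρ * z (M + 1) (m + 2) P (root R k (-γ)) =
        DeltaPlus R ρ k (root R k (-γ)) *
          DeltaMinus R k (omega (M + 1) * root R k (-(γ - 1))) := fun γ => by
    rw [show -(γ - 1) = -γ + 1 by ring, omega_mul_root,
      DeltaPlus_mul_DeltaMinus R ρ hχ (hroot _)]
  have key := exists_cyclic_solution_iff (x := fun γ => t (M + 1) (m + 2) P ρ E (root R k (-γ)))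
    (u := fun γ => DeltaPlus R ρ k (root R k (-γ))) hv hw
  simp only [root_neg_natCast, hA, hD] at key
  rw [fusionTrace, add_comm (classicalA _ _ _ _), ← key]
  constructor
  · rintro ⟨q, hq0, hq⟩
    refine ⟨fun γ => q (-γ), fun h => hq0 (funext fun γ => ?_), fun γ => ?_⟩
    · simpa using congrFun h (-γ)
    · have := hq (-γ)
      rwa [show -γ + 1 = -(γ - 1) by ring, show -γ - 1 = -(γ + 1) by ring] at this
  · rintro ⟨q, hq0, hq⟩
    refine ⟨fun γ => q (-γ), fun h => hq0 (funext fun γ => ?_), fun γ => ?_⟩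
    · simpa using congrFun h (-γ)
    · have := hq (-γ)
      rw [neg_neg] at this
      dsimp only
      rwa [show -(γ + 1) = -γ - 1 by ring, show -(γ - 1) = -γ + 1 by ring]

end Separation

end BBS

theorem theorem2 (N n : ℕ) (hN : 2 ≤ N) (hn : 1 ≤ n) (P : BBS.Params)
    (R : BBS.Amplitudes N n P) (hR : BBS.Generic N n P R) (ρ : ZMod N) (E : ℕ → ℂ) :
    (∀ lam : ℂ,
      BBS.tau N n P ρ E (N + 1) lam
          - BBS.omegaPow N ρ * BBS.z N n P lam * BBS.tau N n P ρ E (N - 1) (BBS.omega N * lam)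
        = BBS.classicalA N P n (lam ^ N) + BBS.classicalD N P n (lam ^ N))
    ↔ ∀ k ∈ Finset.Icc 1 (n - 1),
        ∃ q : ZMod N → ℂ, q ≠ 0 ∧ BBS.IsBaxterSolution R ρ E k q := by
  obtain ⟨M, rfl⟩ : ∃ M, N = M + 1 := ⟨N - 1, by omega⟩
  have hn' : n ∈ Finset.Icc 1 n := Finset.mem_Icc.2 ⟨hn, le_rfl⟩
  simp only [add_tsub_cancel_right, BBS.tau_sub_eq_fusionTrace]
  rw [BBS.fusionTrace_eq_iff (μ := fun k => -R.r n k) hn ρ E]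
  · refine forall₂_congr fun k hk => ?_
    -- The existence of an index k in [1, n - 1] forces n ≥ 2; for n = 1 both sides hold
    -- unconditionally.
    obtain ⟨m, rfl⟩ : ∃ m, n = m + 2 := ⟨n - 2, by
      have := Finset.mem_Icc.1 hk
      omega⟩
    exact (BBS.exists_isBaxterSolution_iff R hR ρ E hk).symm
  · intro k hk
    have := Finset.mem_Icc.1 hk
    exact neg_ne_zero.2 (hR.r_ne n hn' k (Finset.mem_range.2 (by omega)))
  · intro k hk l hl hkl h
    rw [BBS.neg_pow_eq_eps, BBS.neg_pow_eq_eps] at h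
    exact hR.simple n hn' k hk l hl hkl (mul_left_cancel₀ (BBS.eps_ne_zero _) h)
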